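/- A Polish group is a topological group whose topology is Polish (separable and completely metrizable). A Polish group is CLI if it admits a compatible complete metric $d$ that is left invariant, i.e. $d(gh,gk)=d(h,k)$ for all $g,h,k$. For a Polish group $G$, let $E(G)$ be the equivalence relation on $G^{\mathbb N}$ (with the product topology) given by $$x\,E(G)\,y\iff \text{the sequence } \big(x(n)y(n)^{-1}\big)_{n} \text{ converges in } G .$$ For a Polish group $H$ and a Polish $H$-space $Y$ (a Polish space with a continuous action $H\times Y\to Y$), let $E_H^Y$ be the orbit equivalence relation on $Y$: $x\,E_H^Y\,y$ iff $hx=y$ for some $h\in H$. For equivalence relations $E$, $F$ on Polish spaces $X$, $Y$, we say that $E$ is Borel reducible to $F$, written $E\le_B F$, if there is a Borel map $\theta:X\to Y$ with $x\,E\,y\iff\theta(x)\,F\,\theta(y)$ for all $x,y\in X$. Let $S_\infty$ be the group of all permutations of $\mathbb N$ with the topology of pointwise convergence. **Theorem.** (1) Let $G$ be a Polish group that is not CLI and let $H$ be a CLI Polish group. Then $E(G)\not\le_B E_H^Y$ for every Polish $H$-space $Y$. (2) If $H$ is a CLI Polish group, then $E(S_\infty)\not\le_B E(H)$. -/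

import Mathlib

open Filter Topology

/-- A topological group is CLI if it admits a compatible complete left invariant metric. -/
def IsCLI (G : Type*) [Group G] [τ : TopologicalSpace G] : Prop :=
  ∃ d : MetricSpace G,
    d.toUniformSpace.toTopologicalSpace = τ ∧
    @CompleteSpace G d.toUniformSpace ∧
    ∀ g h k : G, d.dist (g * h) (g * k) = d.dist h k

/-- The equivalence relation `E(G)` on `ℕ → G` induced by a topological group `G`:
`x` and `y` are equivalent iff the sequence `x n * (y n)⁻¹` converges in `G`. -/
def groupSetoid (G : Type*) [Group G] [TopologicalSpace G] [IsTopologicalGroup G] :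
    Setoid (ℕ → G) where
  r x y := ∃ g : G, Tendsto (fun n => x n * (y n)⁻¹) atTop (𝓝 g)
  iseqv :=
    { refl := fun x => ⟨1, by simpa using tendsto_const_nhds⟩
      symm := by
        rintro x y ⟨g, hg⟩
        exact ⟨g⁻¹, by simpa using hg.inv⟩
      trans := by
        rintro x y z ⟨g, hg⟩ ⟨h, hh⟩
        exact ⟨g * h, by simpa [mul_assoc] using hg.mul hh⟩ }

/-- `E` is Borel reducible to `F`: there is a Borel map `θ` with `x E y ↔ θ x F θ y`. -/
def BorelReducible {X Y : Type*} [TopologicalSpace X] [TopologicalSpace Y]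
    (E : Setoid X) (F : Setoid Y) : Prop :=
  ∃ θ : X → Y, @Measurable X Y (borel X) (borel Y) θ ∧ ∀ x y : X, E x y ↔ F (θ x) (θ y)

/-- The topology of pointwise convergence on the group `S_∞` of all permutations of `ℕ`
(with `ℕ` discrete). -/
instance permNatTopology : TopologicalSpace (Equiv.Perm ℕ) :=
  TopologicalSpace.induced (fun σ n => σ n) (inferInstance : TopologicalSpace (ℕ → ℕ))

theorem permNat_tendsto_iff {α : Type*} {l : Filter α} {f : α → Equiv.Perm ℕ}
    {σ : Equiv.Perm ℕ} :
    Tendsto f l (𝓝 σ) ↔ ∀ n, ∀ᶠ a in l, f a n = σ n := by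
  rw [nhds_induced, tendsto_comap_iff, tendsto_pi_nhds]
  simp [nhds_discrete]

instance permNat_isTopologicalGroup : IsTopologicalGroup (Equiv.Perm ℕ) where
  continuous_mul := by
    refine continuous_iff_continuousAt.2 fun p => permNat_tendsto_iff.2 fun n => ?_
    have h1 := permNat_tendsto_iff.1 (continuous_fst.tendsto p) (p.2 n)
    have h2 := permNat_tendsto_iff.1 (continuous_snd.tendsto p) n
    filter_upwards [h1, h2] with a ha hb
    simp [Equiv.Perm.mul_apply, hb, ha]
  continuous_inv := by
    refine continuous_iff_continuousAt.2 fun σ => permNat_tendsto_iff.2 fun n => ?_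
    filter_upwards [permNat_tendsto_iff.1 (continuous_id.tendsto σ) (σ⁻¹ n)] with a ha
    rw [Equiv.Perm.inv_eq_iff_eq]
    simpa using ha.symm

/-!
The sequences convergent in `G` form the Polish group `C(ℕ∞, G)`, which acts on `ℕ → G` by termwise
multiplication, and `E(G)` is the orbit equivalence relation of this action
(`groupSetoid_eq_orbitRel`). If `H` is CLI then so is `C(ℕ∞, H)`, so the second claim is a case of
the first, `S_∞` being Polish and not CLI.

For the first claim, call `x` a right Cauchy limit of `y`, for a Polish group `Γ` acting on a Polish
space, if `γ m • y → x` for some sequence `γ` with `γ m' * (γ m)⁻¹ → 1`. Two facts conflict with a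
Borel reduction `θ` from `E(G)` to an orbit equivalence relation of `H`.

* If `H` is CLI, there is a comeagre set such that, for `x`, `y` in it, `θ x` and `θ y` lie in one
  `H`-orbit as soon as `x` is a right Cauchy limit of `y`
  (`exists_residual_forall_smul_eq_of_rightCauchy`). The reason is that on a comeagre set `θ` is
  continuous and generic small displacements by `Γ` are mapped to small displacements by `H`
  (`dense_mem_meagreRegion_displacementSet`). A generic perturbation of `γ` thus yields a right
  Cauchy sequence `u` in `H` with `u k • θ y → θ x`, up to replacing `y` by a point of its orbit, and
  `u` converges as `H` is CLI.
* If `G` is not CLI, it has a right Cauchy sequence `γ` without a limit. For every `y : ℕ → G` the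
  product `γ * y` is a right Cauchy limit of `y`, through the sequences `γ` stopped at `m`, but is
  not equivalent to `y`. As multiplication by `γ` is a homeomorphism, any comeagre set contains such
  a pair.

The Baire category argument concerns sets of pairs that are only analytic. What it needs is that an
analytic set which is nonmeagre in an open set is comeagre in a smaller one
(`MeasureTheory.AnalyticSet.exists_isOpen_isMeagre_diff`), and the easy half of the
Kuratowski–Ulam theorem (`eventually_residual_curry`). The equivalence of CLI with the convergence
of left Cauchy sequences rests on the existence of a left invariant metric for the left uniformity
(`exists_left_invariant_metric`).
-/

/-! ### Completeness of the left uniformity -/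

/-- A Birkhoff–Kakutani theorem. Taking any bounded metric `ρ` for the left uniformity, the
supremum `d x y = ⨆ g, ρ (g * x) (g * y)` is left invariant, and it still induces the left
uniformity since that uniformity is invariant under left translations. -/
theorem exists_left_invariant_metric (G : Type*) [Group G] [TopologicalSpace G]
    [IsTopologicalGroup G] [FirstCountableTopology G] [T2Space G] :
    ∃ d : MetricSpace G, d.toUniformSpace = IsTopologicalGroup.leftUniformSpace G ∧
      ∀ g h k : G, d.dist (g * h) (g * k) = d.dist h k := by
  have hcg : (@uniformity G (IsTopologicalGroup.leftUniformSpace G)).IsCountablyGenerated :=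
    inferInstanceAs (comap (fun p : G × G => p.1⁻¹ * p.2) (𝓝 1)).IsCountablyGenerated
  obtain ⟨I, hI⟩ := @UniformSpace.metrizable_uniformity G (IsTopologicalGroup.leftUniformSpace G)
    hcg
  have hU : @uniformity G I.toUniformSpace = comap (fun p : G × G => p.1⁻¹ * p.2) (𝓝 1) := by
    rw [hI]; rfl
  let ρ : G → G → ℝ := fun x y => min (I.dist x y) 1
  have hbdd (x y : G) : BddAbove (Set.range fun g => ρ (g * x) (g * y)) :=
    ⟨1, by rintro _ ⟨g, rfl⟩; exact min_le_right _ _⟩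
  let D : G → G → ℝ := fun x y => ⨆ g, ρ (g * x) (g * y)
  have hρD (x y) : ρ x y ≤ D x y := by
    simpa using le_ciSup (hbdd x y) 1
  have hsmall (x y : G) {ε : ℝ} (hε : ε ≤ 1) (h : D x y < ε) : I.dist x y < ε := by
    rcases min_lt_iff.1 ((hρD x y).trans_lt h) with h' | h'
    · exact h'
    · linarith
  -- A single neighbourhood of `1` controls `ρ (g * x) (g * y)` simultaneously for all `g`.
  have hlarge {ε : ℝ} (hε : 0 < ε) : ∃ V ∈ 𝓝 (1 : G), ∀ x y, x⁻¹ * y ∈ V → D x y ≤ ε := by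
    have : {p : G × G | I.dist p.1 p.2 < ε} ∈ @uniformity G I.toUniformSpace :=
      Metric.dist_mem_uniformity hε
    rw [hU] at this
    obtain ⟨V, hV, hVs⟩ := this
    refine ⟨V, hV, fun x y hxy => ciSup_le fun g => (min_le_left _ _).trans ?_⟩
    have : ((g * x, g * y) : G × G) ∈ {p : G × G | I.dist p.1 p.2 < ε} :=
      hVs (by simpa [mul_assoc] using hxy)
    exact le_of_lt this
  let d : MetricSpace G :=
    { dist := D
      dist_self := fun x => by simp [D, ρ]
      dist_comm := fun x y => by simp only [D, ρ, dist_comm]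
      dist_triangle := fun x y z => by
        refine ciSup_le fun g => ?_
        have h1 := le_ciSup (hbdd x y) g
        have h2 := le_ciSup (hbdd y z) g
        have h3 : ρ (g * x) (g * z) ≤ ρ (g * x) (g * y) + ρ (g * y) (g * z) := by
          have := dist_triangle (g * x) (g * y) (g * z)
          have ha := dist_nonneg (x := g * x) (y := g * y)
          have hb := dist_nonneg (x := g * y) (y := g * z)
          simp only [ρ]
          rcases min_cases (dist (g * x) (g * y)) 1 with h | h <;>
          rcases min_cases (dist (g * y) (g * z)) 1 with h' | h' <;>
          rcases min_cases (dist (g * x) (g * z)) 1 with h'' | h'' <;> linarith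
        exact h3.trans (add_le_add h1 h2)
      eq_of_dist_eq_zero := fun {x y} hxy => by
        have hins : ∀ V ∈ 𝓝 (1 : G), x⁻¹ * y ∈ V := by
          intro V hV
          have : (fun p : G × G => p.1⁻¹ * p.2) ⁻¹' V ∈ @uniformity G I.toUniformSpace := by
            rw [hU]; exact preimage_mem_comap hV
          obtain ⟨ε, hε, h⟩ := Metric.mem_uniformity_dist.1 this
          have h0 : D x y = 0 := hxy
          refine @h x y (lt_of_lt_of_le (hsmall x y (min_le_right ε 1) ?_) (min_le_left ε 1))
          rw [h0]; positivity
        by_contra hne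
        have : x⁻¹ * y ≠ 1 := fun h => hne (inv_mul_eq_one.1 h)
        exact hins _ (compl_singleton_mem_nhds this.symm) rfl }
  refine ⟨d, UniformSpace.ext ?_, ?_⟩
  · have hU' : @uniformity G (IsTopologicalGroup.leftUniformSpace G)
      = @uniformity G I.toUniformSpace := by rw [hI]
    apply le_antisymm
    · rintro s hs
      rw [hU', hU] at hs
      obtain ⟨V, hV, hVs⟩ := hs
      have : (fun p : G × G => p.1⁻¹ * p.2) ⁻¹' V ∈ @uniformity G I.toUniformSpace := by
        rw [hU]; exact preimage_mem_comap hV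
      obtain ⟨ε, hε, h⟩ := Metric.mem_uniformity_dist.1 this
      refine (@Metric.mem_uniformity_dist G d.toPseudoMetricSpace s).2
        ⟨min ε 1, by positivity, fun {a b} hab => hVs ?_⟩
      exact @h a b ((hsmall a b (min_le_right _ _) hab).trans_le (min_le_left _ _))
    · intro s hs
      obtain ⟨ε, hε, h⟩ := (@Metric.mem_uniformity_dist G d.toPseudoMetricSpace s).1 hs
      obtain ⟨V, hV, hVs⟩ := hlarge (half_pos hε)
      rw [hU', hU]
      refine ⟨V, hV, fun p hp => ?_⟩
      exact @h p.1 p.2 ((hVs _ _ hp).trans_lt (half_lt_self hε))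
  · intro g h k
    change (⨆ a, ρ (a * (g * h)) (a * (g * k))) = ⨆ a, ρ (a * h) (a * k)
    simp only [← mul_assoc]
    exact (Equiv.mulRight g).surjective.iSup_comp (g := fun a => ρ (a * h) (a * k))

/-- `IsCLI` says that every left Cauchy sequence converges. -/
theorem isCLI_iff_leftCauchy_converges {G : Type*} [Group G] [TopologicalSpace G]
    [IsTopologicalGroup G] [FirstCountableTopology G] [T2Space G] :
    IsCLI G ↔ ∀ u : ℕ → G, Tendsto (fun p : ℕ × ℕ => (u p.1)⁻¹ * u p.2) atTop (𝓝 1) →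
      ∃ g, Tendsto u atTop (𝓝 g) := by
  constructor
  · rintro ⟨d, rfl, hc, hd⟩ u hu
    refine cauchySeq_tendsto_of_complete (cauchySeq_iff_tendsto_dist_atTop_0.2 ?_)
    have : ∀ p : ℕ × ℕ, dist (u p.1) (u p.2) = dist ((u p.1)⁻¹ * u p.2) 1 := fun p => by
      rw [dist_comm, ← hd (u p.1)⁻¹, inv_mul_cancel]
    simpa only [this] using tendsto_iff_dist_tendsto_zero.1 hu
  · intro h
    obtain ⟨d, hd, hinv⟩ := exists_left_invariant_metric G
    refine ⟨d, by rw [hd]; rfl, ?_, hinv⟩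
    let := d
    refine UniformSpace.complete_of_cauchySeq_tendsto fun u hu => ?_
    have htop : d.toUniformSpace.toTopologicalSpace = ‹TopologicalSpace G› := by rw [hd]; rfl
    have hu' : Tendsto (fun p : ℕ × ℕ => (u p.1, u p.2)) atTop (@uniformity G d.toUniformSpace) :=
      cauchySeq_iff_tendsto.1 hu
    rw [hd] at hu'
    obtain ⟨g, hg⟩ := h u (tendsto_comap_iff.1 hu')
    exact ⟨g, by rw [htop]; exact hg⟩

/-- In a CLI group, convergence of a sequence can be forced by making the successive left
increments `u (n + 1) * (u n)⁻¹` small. -/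
theorem IsCLI.exists_nhds_one {H : Type*} [Group H] [TopologicalSpace H] [IsTopologicalGroup H]
    (hH : IsCLI H) :
    ∃ W : ℕ → Set H, (∀ n, IsOpen (W n) ∧ 1 ∈ W n) ∧
      ∀ u : ℕ → H, (∀ n, u (n + 1) * (u n)⁻¹ ∈ W n) → ∃ h, Tendsto u atTop (𝓝 h) := by
  obtain ⟨d, rfl, hc, hd⟩ := hH
  refine ⟨fun n => Metric.ball 1 ((1 / 2) ^ n), fun n => ⟨Metric.isOpen_ball, by simp⟩,
    fun u hu => ?_⟩
  have hc : CauchySeq fun n => (u n)⁻¹ := by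
    refine cauchySeq_of_le_geometric (1 / 2) 1 (by norm_num) fun n => ?_
    have h := Metric.mem_ball.1 (hu n)
    rw [← hd (u (n + 1)), mul_inv_cancel, one_mul]
    exact h.le
  obtain ⟨h, hh⟩ := cauchySeq_tendsto_of_complete hc
  exact ⟨h⁻¹, by simpa using hh.inv⟩

/-! ### Baire category: analytic sets and sections -/

/-- The union of all open sets in which `A` is meagre. Its complement is the closed set of points
at which `A` is locally nonmeagre. -/
def meagreRegion {X : Type*} [TopologicalSpace X] (A : Set X) : Set X :=
  ⋃₀ {O | IsOpen O ∧ IsMeagre (O ∩ A)}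

section Baire

variable {X Z : Type*} [TopologicalSpace X] [TopologicalSpace Z]

theorem isOpen_meagreRegion (A : Set X) : IsOpen (meagreRegion A) :=
  isOpen_sUnion fun _ h => h.1

theorem subset_meagreRegion {A O : Set X} (hO : IsOpen O) (h : IsMeagre (O ∩ A)) :
    O ⊆ meagreRegion A :=
  Set.subset_sUnion_of_mem ⟨hO, h⟩

theorem isMeagre_meagreRegion_inter [SecondCountableTopology X] (A : Set X) :
    IsMeagre (meagreRegion A ∩ A) := by
  obtain ⟨T, hTc, hTs, hT⟩ := TopologicalSpace.isOpen_sUnion_countable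
    {O : Set X | IsOpen O ∧ IsMeagre (O ∩ A)} fun _ h => h.1
  rw [meagreRegion, ← hT, Set.sUnion_eq_biUnion, Set.iUnion₂_inter]
  exact isMeagre_biUnion hTc fun O hO => (hTs hO).2

theorem eventually_mem_of_mem_meagreRegion_compl [SecondCountableTopology X] (A : Set X) :
    ∀ᶠ x in residual X, x ∈ meagreRegion Aᶜ → x ∈ A := by
  refine mem_of_superset (isMeagre_meagreRegion_inter Aᶜ) fun x hx h => ?_
  by_contra hA
  exact hx ⟨h, hA⟩

/-- The complement of `meagreRegion A` is the smallest Baire measurable hull of `A`, modulo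
meagre sets. -/
theorem BaireMeasurableSet.isMeagre_diff_meagreRegion {A P : Set X}
    (hP : BaireMeasurableSet P) (h : IsMeagre (P ∩ A)) : IsMeagre (P \ meagreRegion A) := by
  obtain ⟨O, hO, hPO⟩ := hP.residualEq_isOpen
  have h1 : ∀ᶠ x in residual X, x ∈ P ↔ x ∈ O := hPO.mem_iff
  have h2 : O ⊆ meagreRegion A := by
    refine subset_meagreRegion hO ?_
    filter_upwards [h1, h] with x hx hA hxO
    exact hA ⟨hx.2 hxO.1, hxO.2⟩
  filter_upwards [h1] with x hx hxP
  exact hxP.2 (h2 (hx.1 hxP.1))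

/-- Points that are in the Baire hull of an analytic set, but not in the set, form a meagre set.
With `A s` the image of the cylinder of `s`, outside a meagre set a point in the hull of `A s` lies
in the hull of `A (n :: s)` for some `n`; following such choices gives a branch which the
parametrization sends to the point. -/
theorem MeasureTheory.AnalyticSet.isMeagre_compl_meagreRegion_diff [T3Space X]
    [SecondCountableTopology X] {A : Set X} (hA : AnalyticSet A) :
    IsMeagre ((meagreRegion A)ᶜ \ A) := by
  rw [AnalyticSet] at hA
  rcases hA with rfl | ⟨f, hf, rfl⟩
  · have : meagreRegion (∅ : Set X) = Set.univ :=
      Set.univ_subset_iff.1 (subset_meagreRegion isOpen_univ (by simpa using IsMeagre.empty))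
    simpa [this] using IsMeagre.empty
  let B : List ℕ → Set X := fun s => f '' {x | PiNat.res x s.length = s}
  have hB0 : B [] = Set.range f := by simp [B]
  have hBs (s) : B s = ⋃ n, B (n :: s) := by
    ext x
    simp only [B, Set.mem_image, Set.mem_ofPred_eq, Set.mem_iUnion, List.length_cons,
      PiNat.res_succ, List.cons.injEq]
    constructor
    · rintro ⟨a, ha, rfl⟩
      exact ⟨_, a, ⟨rfl, ha⟩, rfl⟩
    · rintro ⟨n, a, ⟨-, ha⟩, rfl⟩
      exact ⟨a, ha, rfl⟩
  have hM (s) : IsMeagre ((⋂ n, meagreRegion (B (n :: s))) \ meagreRegion (B s)) := by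
    refine BaireMeasurableSet.isMeagre_diff_meagreRegion
      (BaireMeasurableSet.iInter fun n => (isOpen_meagreRegion _).baireMeasurableSet) ?_
    rw [hBs s, Set.inter_iUnion]
    exact isMeagre_iUnion fun n => (isMeagre_meagreRegion_inter (B (n :: s))).mono
      (Set.inter_subset_inter_left _ (Set.iInter_subset _ n))
  refine (isMeagre_iUnion hM).mono ?_
  rintro x ⟨hx, hxA⟩
  by_contra hxM
  rw [← hB0] at hx
  have hstep (s : List ℕ) (h : x ∉ meagreRegion (B s)) : ∃ n, x ∉ meagreRegion (B (n :: s)) := by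
    by_contra! hn
    exact hxM (Set.mem_iUnion.2 ⟨s, Set.mem_iInter.2 hn, h⟩)
  choose! next hnext using hstep
  let l : ℕ → List ℕ := fun k => Nat.rec [] (fun _ s => next s :: s) k
  have hl (k) : x ∉ meagreRegion (B (l k)) := by
    induction k with
    | zero => exact hx
    | succ k ih => exact hnext _ ih
  let σ : ℕ → ℕ := fun k => next (l k)
  have hσ (k) : PiNat.res σ k = l k := by
    induction k with
    | zero => rfl
    | succ k ih => rw [PiNat.res_succ, ih]
  refine hxA ⟨σ, ?_⟩
  by_contra hne
  obtain ⟨U, ⟨hU, hUc⟩, hUx⟩ :=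
    (closed_nhds_basis (f σ)).mem_iff.1 (compl_singleton_mem_nhds hne)
  have hpre : f ⁻¹' U ∈ 𝓝 σ := hf.continuousAt hU
  obtain ⟨V, ⟨τ, k, rfl⟩, hσV, hVU⟩ :=
    (PiNat.isTopologicalBasis_cylinders (fun _ : ℕ => ℕ)).mem_nhds_iff.1 hpre
  have hsub : B (l k) ⊆ U := by
    rintro _ ⟨a, ha, rfl⟩
    refine hVU ?_
    rw [← PiNat.mem_cylinder_iff_eq.1 hσV, PiNat.cylinder_eq_res]
    have hlen : (l k).length = k := by rw [← hσ, PiNat.res_length]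
    change PiNat.res a _ = l k at ha
    rw [hlen] at ha
    change PiNat.res a k = PiNat.res σ k
    rw [ha, hσ]
  refine hl k (subset_meagreRegion hUc.isOpen_compl ?_ fun hxU => hUx hxU rfl)
  rw [Set.disjoint_iff_inter_eq_empty.1 (Set.disjoint_compl_left_iff_subset.2 hsub)]
  exact IsMeagre.empty

/-- An analytic set that is nonmeagre in an open set is comeagre in some smaller nonempty open
set. -/
theorem MeasureTheory.AnalyticSet.exists_isOpen_isMeagre_diff [T3Space X]
    [SecondCountableTopology X] {A B : Set X} (hA : AnalyticSet A) (hB : IsOpen B)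
    (h : ¬ IsMeagre (B ∩ A)) : ∃ O ⊆ B, IsOpen O ∧ O.Nonempty ∧ IsMeagre (O \ A) := by
  refine ⟨B ∩ interior (meagreRegion A)ᶜ, Set.inter_subset_left, hB.inter isOpen_interior, ?_, ?_⟩
  · by_contra hemp
    rw [Set.not_nonempty_iff_eq_empty] at hemp
    refine h ?_
    have hfr : IsMeagre ((meagreRegion A)ᶜ \ interior (meagreRegion A)ᶜ) := by
      have hcl := (isOpen_meagreRegion A).isClosed_compl
      rw [← hcl.frontier_eq]
      refine IsNowhereDense.isMeagre ?_
      rw [isClosed_frontier.isNowhereDense_iff, interior_frontier hcl]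
    refine (hfr.union (isMeagre_meagreRegion_inter A)).mono ?_
    rintro x ⟨hxB, hxA⟩
    by_cases hx : x ∈ meagreRegion A
    · exact Or.inr ⟨hx, hxA⟩
    · exact Or.inl ⟨hx, fun hi => (Set.eq_empty_iff_forall_notMem.1 hemp x) ⟨hxB, hi⟩⟩
  · refine hA.isMeagre_compl_meagreRegion_diff.mono ?_
    rintro x ⟨⟨-, hx⟩, hxA⟩
    exact ⟨interior_subset hx, hxA⟩

/-- One half of the Kuratowski–Ulam theorem: almost every section of a comeagre set is comeagre. -/
theorem eventually_residual_curry [SecondCountableTopology Z] {P : X × Z → Prop}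
    (h : ∀ᶠ p in residual (X × Z), P p) :
    ∀ᶠ x in residual X, ∀ᶠ z in residual Z, P (x, z) := by
  obtain ⟨S, hSo, hSd, hSc, hS⟩ := mem_residual_iff.1 h
  have key : ∀ t ∈ S, ∀ᶠ x in residual X, ∀ᶠ z in residual Z, (x, z) ∈ t := by
    intro t ht
    have hV : ∀ V ∈ TopologicalSpace.countableBasis Z,
        ∀ᶠ x in residual X, ∃ z ∈ V, (x, z) ∈ t := by
      intro V hV
      have hVo := TopologicalSpace.isOpen_of_mem_countableBasis hV
      refine residual_of_dense_open ?_ ?_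
      · have : {x | ∃ z ∈ V, (x, z) ∈ t} = Prod.fst '' ((Set.univ ×ˢ V) ∩ t) := by
          ext x; simp [and_comm]
        rw [this]
        exact isOpenMap_fst _ ((isOpen_univ.prod hVo).inter (hSo t ht))
      · rw [dense_iff_inter_open]
        rintro U hU ⟨u, hu⟩
        obtain ⟨v, hv⟩ := TopologicalSpace.nonempty_of_mem_countableBasis hV
        obtain ⟨⟨a, b⟩, hab, hat⟩ :=
          (hSd t ht).inter_open_nonempty _ (hU.prod hVo) ⟨(u, v), hu, hv⟩
        exact ⟨a, hab.1, b, hab.2, hat⟩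
    filter_upwards [(eventually_countable_ball
      (TopologicalSpace.countable_countableBasis Z)).2 hV] with x hx
    refine residual_of_dense_open ((hSo t ht).preimage (Continuous.prodMk_right x)) ?_
    rw [(TopologicalSpace.isBasis_countableBasis Z).dense_iff]
    intro V hV _
    obtain ⟨z, hz, hzt⟩ := hx V hV
    exact ⟨z, hz, hzt⟩
  filter_upwards [(eventually_countable_ball hSc).2 key] with x hx
  filter_upwards [(eventually_countable_ball hSc).2 hx] with z hz
  exact hS (Set.mem_sInter.2 hz)

theorem eventually_residual_curry_swap [SecondCountableTopology X] {P : X × Z → Prop}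
    (h : ∀ᶠ p in residual (X × Z), P p) :
    ∀ᶠ z in residual Z, ∀ᶠ x in residual X, P (x, z) :=
  eventually_residual_curry (P := fun p : Z × X => P p.swap)
    ((tendsto_residual_of_isOpenMap (Homeomorph.prodComm Z X).continuous
      (Homeomorph.prodComm Z X).isOpenMap).eventually h)

/-- A Borel map into a second countable space is continuous on a comeagre set. -/
theorem Measurable.exists_residual_continuousOn [MeasurableSpace X] [BorelSpace X]
    [MeasurableSpace Z] [OpensMeasurableSpace Z] [SecondCountableTopology Z] {f : X → Z}
    (hf : Measurable f) : ∃ C ∈ residual X, ContinuousOn f C := by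
  have hO : ∀ V ∈ TopologicalSpace.countableBasis Z,
      ∃ U : Set X, IsOpen U ∧ ∀ᶠ x in residual X, f x ∈ V ↔ x ∈ U := by
    intro V hV
    obtain ⟨U, hU, h⟩ :=
      (hf (TopologicalSpace.isOpen_of_mem_countableBasis hV).measurableSet).residualEq_isOpen
    exact ⟨U, hU, h.mem_iff⟩
  choose! U hU hfU using hO
  refine ⟨{x | ∀ V ∈ TopologicalSpace.countableBasis Z, f x ∈ V ↔ x ∈ U V},
    (eventually_countable_ball (TopologicalSpace.countable_countableBasis Z)).2 hfU,
    fun x hx => ?_⟩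
  refine ((TopologicalSpace.isBasis_countableBasis Z).nhds_hasBasis).tendsto_right_iff.2 ?_
  rintro V ⟨hV, hxV⟩
  filter_upwards [self_mem_nhdsWithin,
    mem_nhdsWithin_of_mem_nhds ((hU V hV).mem_nhds ((hx V hV).1 hxV))] with y hy hyU
  exact (hy V hV).2 hyU

end Baire

/-! ### Borel homomorphisms between orbit equivalence relations -/

/-- The set of pairs `(γ, x)` such that `θ` maps the displacement from `x` to `γ • x` to one
realized by an element of `W`. -/
def displacementSet {Γ X H Y : Type*} [SMul Γ X] [SMul H Y] (θ : X → Y) (W : Set H) :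
    Set (Γ × X) :=
  {p | ∃ h ∈ W, h • θ p.2 = θ (p.1 • p.2)}

section Orbits

variable {Γ X H Y : Type*}
  [Group Γ] [TopologicalSpace Γ] [PolishSpace Γ]
  [TopologicalSpace X] [PolishSpace X] [MulAction Γ X] [ContinuousSMul Γ X]
  [Group H] [TopologicalSpace H] [PolishSpace H]
  [TopologicalSpace Y] [PolishSpace Y] [MulAction H Y] [ContinuousSMul H Y]

theorem analyticSet_displacementSet [MeasurableSpace X] [BorelSpace X] [MeasurableSpace Y]
    [BorelSpace Y] {θ : X → Y} (hθ : Measurable θ) {W : Set H} (hW : IsOpen W) :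
    MeasureTheory.AnalyticSet (displacementSet θ W : Set (Γ × X)) := by
  borelize Γ H
  have hs : MeasurableSet
      {q : (Γ × X) × H | q.2 ∈ W ∧ q.2 • θ q.1.2 = θ (q.1.1 • q.1.2)} := by
    refine (measurable_snd hW.measurableSet).inter (measurableSet_eq_fun ?_ ?_)
    · exact (continuous_smul (M := H) (X := Y)).measurable.comp
        (measurable_snd.prodMk (hθ.comp (measurable_snd.comp measurable_fst)))
    · exact hθ.comp ((continuous_smul (M := Γ) (X := X)).measurable.comp measurable_fst)
  convert hs.analyticSet_image (measurable_fst : Measurable (Prod.fst : (Γ × X) × H → Γ × X))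
  ext p
  simp [displacementSet]

variable [IsTopologicalGroup Γ] [IsTopologicalGroup H]

/-- Almost everywhere, `θ` maps small displacements to small displacements. The group `H` is covered
by countably many translates `V * c`, so in any box near `(1, x₁)` some `displacementSet θ (V * c)`
is nonmeagre, hence comeagre in a smaller open set `O`. Two displacements `a`, `v * a` of the same
point, both in `O`, then exhibit the displacement `v` as realized by an element of
`V * V⁻¹ ⊆ W`. -/
theorem dense_mem_meagreRegion_displacementSet [MeasurableSpace X] [BorelSpace X]
    [MeasurableSpace Y] [BorelSpace Y] {θ : X → Y} (hθ : Measurable θ)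
    (hhom : ∀ (γ : Γ) (x : X), ∃ h : H, h • θ x = θ (γ • x))
    {W : Set H} (hW : IsOpen W) (h1W : 1 ∈ W) :
    Dense {x : X | ((1 : Γ), x) ∈ meagreRegion (displacementSet θ W)ᶜ} := by
  rw [dense_iff_inter_open]
  rintro U₀ hU₀ ⟨x₁, hx₁⟩
  obtain ⟨V, hVo, h1V, hVW⟩ : ∃ V : Set H, IsOpen V ∧ 1 ∈ V ∧ ∀ a ∈ V, ∀ b ∈ V, a * b⁻¹ ∈ W := by
    obtain ⟨V, hV, h⟩ := exists_nhds_split_inv (hW.mem_nhds h1W)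
    refine ⟨interior V, isOpen_interior, mem_interior_iff_mem_nhds.2 hV, fun a ha b hb => ?_⟩
    simpa [div_eq_mul_inv] using h a (interior_subset ha) b (interior_subset hb)
  let c : ℕ → H := TopologicalSpace.denseSeq H
  let W' : ℕ → Set H := fun i => {w | w * (c i)⁻¹ ∈ V}
  have hW'o (i) : IsOpen (W' i) := hVo.preimage (continuous_mul_const _)
  have hcover (h : H) : ∃ i, h ∈ W' i := by
    have ho : IsOpen {k : H | h * k⁻¹ ∈ V} :=
      hVo.preimage (continuous_const.mul continuous_inv)
    obtain ⟨k, hk, i, rfl⟩ :=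
      (TopologicalSpace.denseRange_denseSeq H).inter_open_nonempty _ ho ⟨h, by simpa using h1V⟩
    exact ⟨i, hk⟩
  let B : Set (Γ × X) := {p | p.1 • p.2 ∈ U₀}
  have hBo : IsOpen B := hU₀.preimage continuous_smul
  obtain ⟨i, hi⟩ : ∃ i, ¬ IsMeagre (B ∩ displacementSet θ (W' i)) := by
    by_contra! hall
    refine not_isMeagre_of_isOpen hBo ⟨(1, x₁), by simpa [B] using hx₁⟩
      ((isMeagre_iUnion hall).mono fun p hp => ?_)
    obtain ⟨h, hh⟩ := hhom p.1 p.2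
    obtain ⟨i, hi⟩ := hcover h
    exact Set.mem_iUnion.2 ⟨i, hp, h, hi, hh⟩
  obtain ⟨O, hOB, hO, ⟨⟨γ₀, x₀⟩, hOne⟩, hOm⟩ :=
    (analyticSet_displacementSet hθ (hW'o i)).exists_isOpen_isMeagre_diff hBo hi
  have hOae : ∀ᶠ p in residual (Γ × X), p ∈ O → p ∈ displacementSet θ (W' i) := by
    refine mem_of_superset hOm fun p hp hpO => ?_
    by_contra hd
    exact hp ⟨hpO, hd⟩
  let Φ : Γ × (Γ × X) ≃ₜ Γ × (Γ × X) :=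
    { toFun := fun t => (t.2.1, (t.1, t.1⁻¹ • t.2.2))
      invFun := fun t => (t.2.1, (t.1, t.2.1 • t.2.2))
      left_inv := fun t => by simp
      right_inv := fun t => by simp
      continuous_toFun := by fun_prop
      continuous_invFun := by fun_prop }
  let Ψ : Γ × (Γ × X) ≃ₜ Γ × (Γ × X) :=
    { toFun := fun t => (t.1, (t.2.1 * t.1, t.1⁻¹ • t.2.2))
      invFun := fun t => (t.1, (t.2.1 * t.1⁻¹, t.1 • t.2.2))
      left_inv := fun t => by simp
      right_inv := fun t => by simp
      continuous_toFun := by fun_prop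
      continuous_invFun := by fun_prop }
  have hΦ := (tendsto_residual_of_isOpenMap (continuous_snd.comp Φ.continuous)
    (isOpenMap_snd.comp Φ.isOpenMap)).eventually hOae
  have hΨ := (tendsto_residual_of_isOpenMap (continuous_snd.comp Ψ.continuous)
    (isOpenMap_snd.comp Ψ.isOpenMap)).eventually hOae
  let Ω : Set (Γ × (Γ × X)) := {t | (t.1, t.1⁻¹ • t.2.2) ∈ O ∧ (t.2.1 * t.1, t.1⁻¹ • t.2.2) ∈ O}
  have hΩo : IsOpen Ω := (hO.preimage (continuous_snd.comp Φ.continuous)).inter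
    (hO.preimage (continuous_snd.comp Ψ.continuous))
  have hΩ : ∀ᶠ t in residual (Γ × (Γ × X)), t ∈ Ω → t.2 ∈ displacementSet θ W := by
    filter_upwards [hΦ, hΨ] with t h1 h2 ht
    obtain ⟨w, hw, hwe⟩ := h1 ht.1
    obtain ⟨w', hw', hwe'⟩ := h2 ht.2
    refine ⟨w' * w⁻¹, by simpa using hVW _ hw' _ hw, ?_⟩
    simp only [Φ, Ψ, Function.comp, Homeomorph.homeomorph_mk_coe, Equiv.coe_fn_mk, mul_smul,
      smul_inv_smul] at hwe hwe'
    rw [← hwe, mul_smul, inv_smul_smul, hwe']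
  have hne : {a : Γ | (a, ((1 : Γ), γ₀ • x₀)) ∈ Ω}.Nonempty := ⟨γ₀, by simpa [Ω] using hOne⟩
  have ho : IsOpen {a : Γ | (a, ((1 : Γ), γ₀ • x₀)) ∈ Ω} :=
    hΩo.preimage (Continuous.prodMk_left _)
  obtain ⟨a, haΩ, ha⟩ :=
    (dense_of_mem_residual (eventually_residual_curry hΩ)).inter_open_nonempty _ ho hne
  refine ⟨γ₀ • x₀, hOB hOne, subset_meagreRegion (O := {q | (a, q) ∈ Ω})
    (hΩo.preimage (Continuous.prodMk_right a)) ?_ haΩ⟩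
  refine mem_of_superset ha fun q hq hqm => hqm.2 (hq hqm.1)

/-- A Borel homomorphism `θ` from the orbit equivalence relation of a Polish group `Γ` to that of a
CLI group preserves, on a comeagre set, the relation "`γ m • y` tends to `x` for some right Cauchy
sequence `γ`", and in the target this relation implies orbit equivalence.

The sequence `γ` is perturbed to a generic sequence `δ` along which `θ (δ (k + 1) • y)` is obtained
from `θ (δ k • y)` by elements of `H` that are so small that their products converge. -/
theorem exists_residual_forall_smul_eq_of_rightCauchy (hH : IsCLI H)
    [MeasurableSpace X] [BorelSpace X] [MeasurableSpace Y] [BorelSpace Y] {θ : X → Y}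
    (hθ : Measurable θ) (hhom : ∀ (γ : Γ) (x : X), ∃ h : H, h • θ x = θ (γ • x)) :
    ∃ C ∈ residual X, ∀ x ∈ C, ∀ y ∈ C, ∀ γ : ℕ → Γ,
      Tendsto (fun m => γ m • y) atTop (𝓝 x) →
      Tendsto (fun p : ℕ × ℕ => γ p.2 * (γ p.1)⁻¹) atTop (𝓝 1) →
      ∃ h : H, h • θ y = θ x := by
  obtain ⟨W, hW, hWconv⟩ := hH.exists_nhds_one
  obtain ⟨C₁, hC₁, hθC⟩ := hθ.exists_residual_continuousOn
  let R : ℕ → Set (Γ × X) := fun j => displacementSet θ (W j)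
  have h₂ : ∀ᶠ x in residual X, ∀ j, ((1 : Γ), x) ∈ meagreRegion (R j)ᶜ :=
    eventually_countable_forall.2 fun j => residual_of_dense_open
      ((isOpen_meagreRegion _).preimage (Continuous.prodMk_right _))
      (dense_mem_meagreRegion_displacementSet hθ hhom (hW j).1 (hW j).2)
  have h₃ : ∀ᶠ x in residual X, ∀ j, ∀ᶠ v in residual Γ,
      (v, x) ∈ meagreRegion (R j)ᶜ → (v, x) ∈ R j :=
    eventually_countable_forall.2 fun j =>
      eventually_residual_curry_swap (eventually_mem_of_mem_meagreRegion_compl (R j))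
  let C₀ : Set X := {x | x ∈ C₁ ∧ (∀ j, ((1 : Γ), x) ∈ meagreRegion (R j)ᶜ) ∧
    ∀ j, ∀ᶠ v in residual Γ, (v, x) ∈ meagreRegion (R j)ᶜ → (v, x) ∈ R j}
  have hC₀ : C₀ ∈ residual X := (show ∀ᶠ x in residual X, x ∈ C₁ from hC₁).and (h₂.and h₃)
  have hact : ∀ᶠ x in residual X, ∀ᶠ v in residual Γ, v • x ∈ C₀ := by
    let Φ : Γ × X ≃ₜ Γ × X :=
      { toFun := fun t => (t.1, t.1 • t.2)
        invFun := fun t => (t.1, t.1⁻¹ • t.2)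
        left_inv := fun t => by simp
        right_inv := fun t => by simp
        continuous_toFun := by fun_prop
        continuous_invFun := by fun_prop }
    exact eventually_residual_curry_swap ((tendsto_residual_of_isOpenMap
      (continuous_snd.comp Φ.continuous) (isOpenMap_snd.comp Φ.isOpenMap)).eventually hC₀)
  refine ⟨{x | x ∈ C₀ ∧ ∀ᶠ v in residual Γ, v • x ∈ C₀}, hact.and hC₀ |>.mono fun x h => h.symm,
    ?_⟩
  rintro x ⟨hx, -⟩ y ⟨-, hy⟩ γ hγx hγ
  -- The filter of small left perturbations of the tails of `γ`.
  let F : Filter Γ := map (fun p : Γ × ℕ => p.1 * γ p.2) (𝓝 1 ×ˢ atTop)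
  have hFx : Tendsto (fun δ : Γ => δ • y) F (𝓝 x) := by
    refine tendsto_map'_iff.2 ?_
    have h := (tendsto_fst (f := 𝓝 (1 : Γ)) (g := (atTop : Filter ℕ))).smul
      (hγx.comp tendsto_snd)
    simpa [Function.comp_def, mul_smul] using h
  have hFF : Tendsto (fun p : Γ × Γ => p.2 * p.1⁻¹) (F ×ˢ F) (𝓝 1) := by
    simp only [F]
    rw [prod_map_map_eq, tendsto_map'_iff]
    have ha : Tendsto (fun q : (Γ × ℕ) × (Γ × ℕ) => q.1.1)
        ((𝓝 1 ×ˢ atTop) ×ˢ (𝓝 1 ×ˢ atTop)) (𝓝 1) := tendsto_fst.comp tendsto_fst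
    have hb : Tendsto (fun q : (Γ × ℕ) × (Γ × ℕ) => q.2.1)
        ((𝓝 1 ×ˢ atTop) ×ˢ (𝓝 1 ×ˢ atTop)) (𝓝 1) := tendsto_fst.comp tendsto_snd
    have hc : Tendsto (fun q : (Γ × ℕ) × (Γ × ℕ) => γ q.2.2 * (γ q.1.2)⁻¹)
        ((𝓝 1 ×ˢ atTop) ×ˢ (𝓝 1 ×ˢ atTop)) (𝓝 1) := by
      rw [← prod_atTop_atTop_eq] at hγ
      exact hγ.comp ((tendsto_snd.comp tendsto_fst).prodMk (tendsto_snd.comp tendsto_snd))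
    have h := (hb.mul hc).mul ha.inv
    simpa [Function.comp_def, mul_assoc] using h
  have hFgen : ∀ S ∈ residual Γ, ∃ᶠ δ in F, δ ∈ S := by
    intro S hS
    refine frequently_iff.2 fun {E} hE => ?_
    obtain ⟨V, hV, T, hT, hVT⟩ := mem_prod_iff.1 (mem_map.1 hE)
    obtain ⟨m, hm⟩ := (atTop : Filter ℕ).nonempty_of_mem hT
    obtain ⟨δ, hδ, hδS⟩ := (dense_of_mem_residual hS).inter_open_nonempty
      ((fun δ => δ * (γ m)⁻¹) ⁻¹' interior V)
      (isOpen_interior.preimage (continuous_mul_const _))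
      ⟨γ m, by simpa using mem_interior_iff_mem_nhds.2 hV⟩
    refine ⟨δ, ?_, hδS⟩
    have : (δ * (γ m)⁻¹, m) ∈ V ×ˢ T := ⟨interior_subset hδ, hm⟩
    simpa using hVT this
  obtain ⟨B, hB⟩ := F.exists_antitone_basis
  have hS : ∀ k, ∃ S ∈ F, ∀ δ ∈ S, ∀ δ' ∈ S,
      (δ' * δ⁻¹, δ • y) ∈ meagreRegion (R k)ᶜ := by
    intro k
    have h : Tendsto (fun p : Γ × Γ => (p.2 * p.1⁻¹, p.1 • y)) (F ×ˢ F) (𝓝 (1, x)) :=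
      hFF.prodMk_nhds (hFx.comp tendsto_fst)
    obtain ⟨S, hSF, h⟩ := mem_prod_self_iff.1
      (h ((isOpen_meagreRegion _).mem_nhds (hx.2.1 k)))
    exact ⟨S, hSF, fun δ hδ δ' hδ' => h (Set.mk_mem_prod hδ hδ')⟩
  choose S hSF hSO using hS
  replace hSF (k) : ∀ᶠ δ in F, δ ∈ S k := hSF k
  let P : ℕ → Γ → Prop := fun k δ => δ ∈ S k ∧ δ ∈ B k ∧ δ • y ∈ C₀
  obtain ⟨δ₀, hδ₀⟩ : ∃ δ, P 0 δ := by
    obtain ⟨δ, h1, h2⟩ := ((hFgen _ hy).and_eventually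
      ((hSF 0).and (hB.mem 0))).exists
    exact ⟨δ, h2.1, h2.2, h1⟩
  have hstep : ∀ k δ, P k δ →
      ∃ δ', P (k + 1) δ' ∧ ∃ w ∈ W k, w • θ (δ • y) = θ (δ' • y) := by
    intro k δ hδ
    -- `δ • y` is generic, so generic displacements of it by elements close to `1` are small in `H`.
    have hgen : ∀ᶠ δ' in residual Γ,
        (δ' * δ⁻¹, δ • y) ∈ meagreRegion (R k)ᶜ → (δ' * δ⁻¹, δ • y) ∈ R k :=
      (tendsto_residual_of_isOpenMap (Homeomorph.mulRight δ⁻¹).continuous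
        (Homeomorph.mulRight δ⁻¹).isOpenMap).eventually (hδ.2.2.2.2 k)
    obtain ⟨δ', ⟨h1, h2⟩, h3, h4, h5⟩ := ((hFgen _ (hy.and hgen)).and_eventually
      ((hSF k).and ((hSF (k + 1)).and (hB.mem (k + 1))))).exists
    obtain ⟨w, hw, hwe⟩ := h2 (hSO k δ hδ.1 δ' h3)
    refine ⟨δ', ⟨h4, h5, h1⟩, w, hw, ?_⟩
    simpa [mul_smul] using hwe
  choose! next hnextP w hw hwe using hstep
  let δ : ℕ → Γ := fun k => Nat.rec δ₀ (fun k δ => next k δ) k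
  have hδP (k) : P k (δ k) := by
    induction k with
    | zero => exact hδ₀
    | succ k ih => exact hnextP k _ ih
  let u : ℕ → H := fun k => Nat.rec 1 (fun k h => w k (δ k) * h) k
  have hu (k) : u k • θ (δ 0 • y) = θ (δ k • y) := by
    induction k with
    | zero => exact one_smul _ _
    | succ k ih =>
      change (w k (δ k) * u k) • _ = _
      rw [mul_smul, ih]
      exact hwe k _ (hδP k)
  obtain ⟨h, hh⟩ := hWconv u fun k => by
    change w k (δ k) * u k * (u k)⁻¹ ∈ W k
    rw [mul_inv_cancel_right]
    exact hw k _ (hδP k)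
  have hδF : Tendsto δ atTop F := hB.tendsto fun k => (hδP k).2.1
  have hlim : Tendsto (fun k => θ (δ k • y)) atTop (𝓝 (θ x)) :=
    (hθC x hx.1).tendsto.comp (tendsto_nhdsWithin_iff.2
      ⟨hFx.comp hδF, Eventually.of_forall fun k => (hδP k).2.2.1⟩)
  have hlim' : Tendsto (fun k => θ (δ k • y)) atTop (𝓝 (h • θ (δ 0 • y))) := by
    simpa only [hu] using hh.smul_const (θ (δ 0 • y))
  obtain ⟨g, hg⟩ := hhom (δ 0) y
  exact ⟨h * g, by rw [mul_smul, hg]; exact tendsto_nhds_unique hlim' hlim⟩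

end Orbits

/-! ### The group of convergent sequences

A convergent sequence in `G`, together with its limit, is a continuous map `ℕ∞ → G`, and the
compact-open topology on `C(ℕ∞, G)` is the topology of uniform convergence. -/

section ConvergentSequences

variable {G : Type*} [Group G] [TopologicalSpace G] [IsTopologicalGroup G]

instance continuousMap_isTopologicalGroup : IsTopologicalGroup C(ℕ∞, G) where
  continuous_inv := ContinuousMap.continuous_postcomp ⟨fun g : G => g⁻¹, continuous_inv⟩

instance continuousMap_polishSpace [PolishSpace G] : PolishSpace C(ℕ∞, G) := by
  let := TopologicalSpace.upgradeIsCompletelyMetrizable G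
  infer_instance

theorem IsCLI.continuousMap {G : Type*} [Group G] [TopologicalSpace G] [IsTopologicalGroup G]
    (hG : IsCLI G) : IsCLI C(ℕ∞, G) := by
  obtain ⟨d, rfl, hc, hd⟩ := hG
  refine ⟨ContinuousMap.instMetricSpace ℕ∞, rfl, inferInstance, fun g h k => ?_⟩
  refine (ContinuousMap.dist_eq_iSup (f := g * h) (g := g * k)).trans
    (Eq.trans ?_ (ContinuousMap.dist_eq_iSup (f := h) (g := k)).symm)
  exact iSup_congr fun n => hd (g n) (h n) (k n)

/-- The group of convergent sequences in `G` acts on all sequences in `G` by termwise left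
multiplication. -/
instance convergentSequencesAction : MulAction C(ℕ∞, G) (ℕ → G) where
  smul γ x := fun n => γ n * x n
  one_smul x := funext fun n => one_mul (x n)
  mul_smul γ δ x := funext fun n => mul_assoc (γ n) (δ n) (x n)

theorem convergentSequence_smul_apply (γ : C(ℕ∞, G)) (x : ℕ → G) (n : ℕ) :
    (γ • x) n = γ n * x n :=
  rfl

instance convergentSequencesAction_continuousSMul : ContinuousSMul C(ℕ∞, G) (ℕ → G) where
  continuous_smul := continuous_pi fun n =>
    ((continuous_eval_const (n : ℕ∞)).comp continuous_fst).mul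
      ((continuous_apply n).comp continuous_snd)

/-- The continuous map on `ℕ∞` given by a convergent sequence and its limit. -/
def convergentSequence {G : Type*} [TopologicalSpace G] (u : ℕ → G) (g : G)
    (h : Tendsto u atTop (𝓝 g)) : C(ℕ∞, G) where
  toFun n := n.recTopCoe g u
  continuous_toFun := by
    refine continuous_iff_continuousAt.2 fun n => ?_
    induction n using ENat.recTopCoe with
    | coe n => rw [ContinuousAt, ENat.nhds_natCast]; exact tendsto_pure_nhds _ _
    | top =>
      intro U hU
      obtain ⟨N, hN⟩ := eventually_atTop.1 (h hU)
      refine mem_map.2 (mem_of_superset (Ioi_mem_nhds (ENat.natCast_lt_top N)) fun n hn => ?_)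
      induction n using ENat.recTopCoe with
      | coe n => exact hN n (Nat.cast_lt.1 (Set.mem_Ioi.1 hn)).le
      | top => exact mem_of_mem_nhds (x := g) hU

theorem groupSetoid_eq_orbitRel : groupSetoid G = MulAction.orbitRel C(ℕ∞, G) (ℕ → G) := by
  ext x y
  rw [MulAction.orbitRel_apply, MulAction.mem_orbit_iff]
  constructor
  · rintro ⟨g, hg⟩
    refine ⟨convergentSequence _ g hg, funext fun n => ?_⟩
    exact inv_mul_cancel_right (x n) (y n)
  · rintro ⟨γ, rfl⟩
    refine ⟨γ ⊤, ?_⟩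
    have h : Tendsto (fun n : ℕ => γ n) atTop (𝓝 (γ ⊤)) :=
      (γ.continuous.tendsto ⊤).comp ENat.tendsto_natCast_nhds_top
    simpa [convergentSequence_smul_apply] using h

/-- The sequence `γ`, made constant from the index `m` on. -/
def stoppedSequence {G : Type*} [TopologicalSpace G] (γ : ℕ → G) (m : ℕ) : C(ℕ∞, G) :=
  convergentSequence (fun n => γ (min n m)) (γ m) <| tendsto_const_nhds.congr' <| by
    filter_upwards [eventually_ge_atTop m] with n hn
    rw [min_eq_right hn]

theorem stoppedSequence_natCast {G : Type*} [TopologicalSpace G] (γ : ℕ → G) (m n : ℕ) :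
    stoppedSequence γ m n = γ (min n m) :=
  rfl

/-- Stopping a right Cauchy sequence of `G` later and later gives a right Cauchy sequence of
convergent sequences. -/
theorem tendsto_stoppedSequence_mul_inv [PolishSpace G] {γ : ℕ → G}
    (hγ : Tendsto (fun p : ℕ × ℕ => γ p.2 * (γ p.1)⁻¹) atTop (𝓝 1)) :
    Tendsto (fun p : ℕ × ℕ => stoppedSequence γ p.2 * (stoppedSequence γ p.1)⁻¹) atTop (𝓝 1) := by
  let := TopologicalSpace.upgradeIsCompletelyMetrizable G
  refine Metric.tendsto_nhds.2 fun ε hε => ?_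
  obtain ⟨N, hN⟩ := eventually_atTop_prod_self.1 (Metric.tendsto_nhds.1 hγ ε hε)
  refine eventually_atTop_prod_self.2 ⟨N, fun i j hi hj => ?_⟩
  refine ContinuousMap.dist_lt_of_nonempty fun n => ?_
  simp only [ContinuousMap.mul_apply, ContinuousMap.inv_apply, ContinuousMap.one_apply]
  induction n using ENat.recTopCoe with
  | top => exact hN i j hi hj
  | coe n =>
    simp only [stoppedSequence_natCast]
    rcases le_total n N with h | h
    · rw [min_eq_left (h.trans hi), min_eq_left (h.trans hj)]
      simpa using hε
    · exact hN _ _ (le_min h hi) (le_min h hj)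

/-- Multiplication by a right Cauchy sequence `γ` of `G` without a limit is a homeomorphism of
`ℕ → G`. Hence every comeagre set contains some `y` together with `γ * y`, and these two are
inequivalent. -/
theorem not_borelReducible_groupSetoid_orbitRel [PolishSpace G] (hG : ¬ IsCLI G)
    {H : Type*} [Group H] [TopologicalSpace H] [IsTopologicalGroup H] [PolishSpace H]
    (hH : IsCLI H) (Y : Type*) [TopologicalSpace Y] [PolishSpace Y] [MulAction H Y]
    [ContinuousSMul H Y] :
    ¬ BorelReducible (groupSetoid G) (MulAction.orbitRel H Y) := by
  rintro ⟨θ, hθ, hred⟩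
  rw [isCLI_iff_leftCauchy_converges] at hG
  push Not at hG
  obtain ⟨u, hu, hnot⟩ := hG
  let γ : ℕ → G := fun n => (u n)⁻¹
  have hγ : Tendsto (fun p : ℕ × ℕ => γ p.2 * (γ p.1)⁻¹) atTop (𝓝 1) := by
    have h := hu.inv
    simpa [γ] using h
  let : MeasurableSpace (ℕ → G) := borel (ℕ → G)
  have : BorelSpace (ℕ → G) := ⟨rfl⟩
  let : MeasurableSpace Y := borel Y
  have : BorelSpace Y := ⟨rfl⟩
  have hhom : ∀ (δ : C(ℕ∞, G)) (x : ℕ → G), ∃ h : H, h • θ x = θ (δ • x) := by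
    intro δ x
    have h : groupSetoid G (δ • x) x := by
      rw [groupSetoid_eq_orbitRel]
      exact ⟨δ, rfl⟩
    exact (hred _ _).1 h
  obtain ⟨C, hC, hCθ⟩ := exists_residual_forall_smul_eq_of_rightCauchy hH hθ hhom
  have hC' : ∀ᶠ y in residual (ℕ → G), γ * y ∈ C :=
    (tendsto_residual_of_isOpenMap (Homeomorph.mulLeft γ).continuous
      (Homeomorph.mulLeft γ).isOpenMap).eventually hC
  obtain ⟨y, hyC, hyC'⟩ := (dense_of_mem_residual (inter_mem hC hC')).nonempty
  have hlim : Tendsto (fun m => stoppedSequence γ m • y) atTop (𝓝 (γ * y)) := by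
    refine tendsto_pi_nhds.2 fun n => tendsto_const_nhds.congr' ?_
    filter_upwards [eventually_ge_atTop n] with m hm
    rw [convergentSequence_smul_apply, stoppedSequence_natCast, min_eq_left hm, Pi.mul_apply]
  obtain ⟨h, hh⟩ := hCθ _ hyC' _ hyC _ hlim (tendsto_stoppedSequence_mul_inv hγ)
  obtain ⟨g, hg⟩ := (hred (γ * y) y).2 ⟨h, hh⟩
  refine hnot g⁻¹ ?_
  simpa [γ] using hg.inv

end ConvergentSequences

/-! ### The group of permutations of `ℕ` -/

instance permNat_polishSpace : PolishSpace (Equiv.Perm ℕ) := by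
  have hemb : IsClosedEmbedding
      (fun σ : Equiv.Perm ℕ => ((fun n => σ n, fun n => σ⁻¹ n) : (ℕ → ℕ) × (ℕ → ℕ))) := by
    have hc : Continuous fun σ : Equiv.Perm ℕ => fun n => σ n := continuous_induced_dom
    refine ⟨⟨IsInducing.of_comp (hc.prodMk (hc.comp continuous_inv)) continuous_fst ⟨rfl⟩,
      fun σ τ h => Equiv.ext fun n => congrFun (congrArg Prod.fst h) n⟩, ?_⟩
    have : Set.range (fun σ : Equiv.Perm ℕ =>
        ((fun n => σ n, fun n => σ⁻¹ n) : (ℕ → ℕ) × (ℕ → ℕ))) =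
        ⋂ n, {p | p.2 (p.1 n) = n ∧ p.1 (p.2 n) = n} := by
      ext ⟨f, g⟩
      simp only [Set.mem_range, Set.mem_iInter, Set.mem_ofPred_eq, Prod.mk.injEq]
      constructor
      · rintro ⟨σ, rfl, rfl⟩ n
        simp
      · intro h
        exact ⟨⟨f, g, fun n => (h n).1, fun n => (h n).2⟩, rfl, rfl⟩
    rw [this]
    have hev : Continuous fun q : (ℕ → ℕ) × ℕ => q.1 q.2 :=
      continuous_prod_of_discrete_right.2 continuous_apply
    refine isClosed_iInter fun n => IsClosed.inter ?_ ?_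
    · exact isClosed_eq (hev.comp (continuous_snd.prodMk
        ((continuous_apply n).comp continuous_fst))) continuous_const
    · exact isClosed_eq (hev.comp (continuous_fst.prodMk
        ((continuous_apply n).comp continuous_snd))) continuous_const
  exact hemb.polishSpace

/-- The cycles `0 ↦ 1 ↦ ⋯ ↦ n ↦ 0` form a left Cauchy sequence: they converge pointwise to the
successor function, which is not surjective. -/
theorem not_isCLI_permNat : ¬ IsCLI (Equiv.Perm ℕ) := by
  rw [isCLI_iff_leftCauchy_converges]
  intro h
  let σ : ℕ → Equiv.Perm ℕ := fun n =>
    { toFun := fun k => if k < n then k + 1 else if k = n then 0 else k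
      invFun := fun k => if k = 0 then n else if k ≤ n then k - 1 else k
      left_inv := fun k => by grind
      right_inv := fun k => by grind }
  have hσ {k n : ℕ} (hkn : k < n) : σ n k = k + 1 := if_pos hkn
  obtain ⟨τ, hτ⟩ := h σ <| permNat_tendsto_iff.2 fun k => by
    refine eventually_atTop_prod_self.2 ⟨k + 1, fun i j hi hj => ?_⟩
    rw [Equiv.Perm.mul_apply, Equiv.Perm.inv_eq_iff_eq, hσ hj, Equiv.Perm.one_apply, hσ hi]
  rw [permNat_tendsto_iff] at hτ
  obtain ⟨n, hn, hlt⟩ := ((hτ (τ.symm 0)).and (eventually_gt_atTop (τ.symm 0))).exists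
  rw [hσ hlt, Equiv.apply_symm_apply] at hn
  exact Nat.succ_ne_zero _ hn

theorem theorem1p2 :
    (∀ (G : Type*) [Group G] [TopologicalSpace G] [IsTopologicalGroup G] [PolishSpace G]
        (H : Type*) [Group H] [TopologicalSpace H] [IsTopologicalGroup H] [PolishSpace H],
        ¬ IsCLI G → IsCLI H →
        ∀ (Y : Type*) [TopologicalSpace Y] [PolishSpace Y] [MulAction H Y] [ContinuousSMul H Y],
          ¬ BorelReducible (groupSetoid G) (MulAction.orbitRel H Y)) ∧
    (∀ (H : Type*) [Group H] [TopologicalSpace H] [IsTopologicalGroup H] [PolishSpace H],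
        IsCLI H → ¬ BorelReducible (groupSetoid (Equiv.Perm ℕ)) (groupSetoid H)) := by
  refine ⟨fun G _ _ _ _ H _ _ _ _ hG hH Y _ _ _ _ =>
    not_borelReducible_groupSetoid_orbitRel hG hH Y, fun H _ _ _ _ hH => ?_⟩
  rw [groupSetoid_eq_orbitRel (G := H)]
  exact not_borelReducible_groupSetoid_orbitRel not_isCLI_permNat hH.continuousMap (ℕ → H)
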